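/- Let $\Omega\subset\mathbb{R}^3$ be a bounded open set with Lipschitz boundary, that is: every $x\in\partial\Omega$ has an open neighbourhood $V$ in which, for suitable orthonormal coordinates $(y_1,y_2,y_3)$ and some Lipschitz function $h:\mathbb{R}^2\to\mathbb{R}$, one has $\Omega\cap V=\{y\in V : y_3>h(y_1,y_2)\}$. (In particular, $\Omega$ may be any bounded Lipschitz domain; connectedness is not needed.) Let $1<p<\infty$. Let $$W^p(\mathrm{curl};\Omega)=\{u\in L^p(\Omega)^3 : \nabla\times u\in L^p(\Omega)^3\},\qquad \|u\|_{W^p(\mathrm{curl};\Omega)}=\|u\|_{L^p(\Omega)}+\|\nabla\times u\|_{L^p(\Omega)},$$ where the fields are real-valued and $\nabla\times u$ is the distributional curl, i.e. $\int_\Omega(\nabla\times u)\cdot\varphi\,dx=\int_\Omega u\cdot(\nabla\times\varphi)\,dx$ for all $\varphi\in C_0^\infty(\Omega)^3$. Let $C^\infty(\overline\Omega)^3$ denote the set of restrictions to $\Omega$ of smooth vector fields $\mathbb{R}^3\to\mathbb{R}^3$. Then $C^\infty(\overline\Omega)^3$ is contained in $W^p(\mathrm{curl};\Omega)$ and is dense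 in it. -/

import Mathlib

open MeasureTheory TopologicalSpace
open scoped ENNReal ContDiff InnerProductSpace

noncomputable section

/-- Three-dimensional Euclidean space `ℝ³` (with the Euclidean norm and Lebesgue measure). -/
abbrev R3 : Type := EuclideanSpace ℝ (Fin 3)

/-- `Ω` has a Lipschitz boundary: near each boundary point, in suitable orthonormal coordinates
`(y₀, y₁, y₂)`, the set `Ω` is the region strictly above the graph of a Lipschitz function of
`(y₀, y₁)`; in particular the boundary is, near that point, the graph itself. -/
def HasLipschitzBoundary (Ω : Set R3) : Prop :=
  ∀ x ∈ frontier Ω, ∃ V : Set R3, IsOpen V ∧ x ∈ V ∧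
    ∃ (e : R3 ≃ₗᵢ[ℝ] R3) (K : NNReal) (h : EuclideanSpace ℝ (Fin 2) → ℝ), LipschitzWith K h ∧
      ∀ y ∈ V, (y ∈ Ω ↔ h !₂[e y 0, e y 1] < e y 2)

/-- The partial derivative `∂ᵢ φⱼ` at `x`. -/
def partialDeriv (φ : R3 → R3) (i j : Fin 3) (x : R3) : ℝ :=
  fderiv ℝ φ x (EuclideanSpace.single i 1) j

/-- The classical curl of a (differentiable) vector field. -/
def classicalCurl (φ : R3 → R3) (x : R3) : R3 :=
  !₂[partialDeriv φ 1 2 x - partialDeriv φ 2 1 x,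
     partialDeriv φ 2 0 x - partialDeriv φ 0 2 x,
     partialDeriv φ 0 1 x - partialDeriv φ 1 0 x]

/-- `φ ∈ C₀^∞(Ω)³`: a smooth vector field whose support is a compact subset of `Ω`. -/
structure IsTestField (Ω : Opens R3) (φ : R3 → R3) : Prop where
  contDiff : ContDiff ℝ ∞ φ
  hasCompactSupport : HasCompactSupport φ
  tsupport_subset : tsupport φ ⊆ Ω

/-- `w` is the curl of `u` in `Ω` in the sense of distributions. -/
def IsWeakCurl (Ω : Opens R3) (u w : R3 → R3) : Prop :=
  ∀ φ : R3 → R3, IsTestField Ω φ →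
    ∫ x in (Ω : Set R3), ⟪w x, φ x⟫_ℝ = ∫ x in (Ω : Set R3), ⟪u x, classicalCurl φ x⟫_ℝ

/-- `L^p(Ω)³`. -/
abbrev LpField (p : ℝ≥0∞) (Ω : Opens R3) : Type :=
  Lp R3 p (volume.restrict (Ω : Set R3))

theorem integrable_inner_of_hasCompactSupport {p : ℝ≥0∞} [hp : Fact (1 ≤ p)] {Ω : Opens R3}
    (u : LpField p Ω) {φ : R3 → R3} (hc : Continuous φ) (hs : HasCompactSupport φ) :
    Integrable (fun x => ⟪u x, φ x⟫_ℝ) (volume.restrict (Ω : Set R3)) := by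
  have h1 : LocallyIntegrable u (volume.restrict (Ω : Set R3)) :=
    (Lp.memLp u).locallyIntegrable hp.out
  have h2 : Integrable (fun x => ‖φ x‖ • u x) (volume.restrict (Ω : Set R3)) :=
    h1.integrable_smul_left_of_hasCompactSupport hc.norm hs.norm
  refine h2.mono ((Lp.aestronglyMeasurable u).inner hc.aestronglyMeasurable) ?_
  filter_upwards with x
  rw [norm_smul, norm_norm, mul_comm]
  exact norm_inner_le_norm _ _

theorem continuous_classicalCurl {φ : R3 → R3} (h : ContDiff ℝ ∞ φ) :
    Continuous (classicalCurl φ) := by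
  have hc : ∀ i j, Continuous (partialDeriv φ i j) := fun i j => by
    have h1 : Continuous (fderiv ℝ φ) := h.continuous_fderiv (by simp)
    unfold partialDeriv
    fun_prop
  unfold classicalCurl
  refine (PiLp.continuous_toLp 2 _).comp (continuous_pi fun i => ?_)
  fin_cases i
  · exact (hc 1 2).sub (hc 2 1)
  · exact (hc 2 0).sub (hc 0 2)
  · exact (hc 0 1).sub (hc 1 0)

theorem hasCompactSupport_classicalCurl {φ : R3 → R3} (h : HasCompactSupport φ) :
    HasCompactSupport (classicalCurl φ) := by
  refine (h.fderiv ℝ).mono fun x hx => ?_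
  contrapose! hx
  have h0 : fderiv ℝ φ x = 0 := by simpa using hx
  simp only [Function.mem_support, not_not]
  ext i
  fin_cases i <;> simp [classicalCurl, partialDeriv, h0]

theorem IsWeakCurl.add {p : ℝ≥0∞} [Fact (1 ≤ p)] {Ω : Opens R3} {u u' w w' : LpField p Ω}
    (h : IsWeakCurl Ω u w) (h' : IsWeakCurl Ω u' w') :
    IsWeakCurl Ω (u + u' : LpField p Ω) (w + w' : LpField p Ω) := by
  intro φ hφ
  have key : ∀ (a b : LpField p Ω) (ψ : R3 → R3), Continuous ψ → HasCompactSupport ψ →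
      ∫ x in (Ω : Set R3), ⟪(a + b : LpField p Ω) x, ψ x⟫_ℝ =
        (∫ x in (Ω : Set R3), ⟪a x, ψ x⟫_ℝ) + ∫ x in (Ω : Set R3), ⟪b x, ψ x⟫_ℝ := by
    intro a b ψ hc hs
    rw [← integral_add (integrable_inner_of_hasCompactSupport a hc hs)
      (integrable_inner_of_hasCompactSupport b hc hs)]
    refine integral_congr_ae ?_
    filter_upwards [Lp.coeFn_add a b] with x hx
    rw [hx, Pi.add_apply, inner_add_left]
  rw [key w w' φ hφ.contDiff.continuous hφ.hasCompactSupport,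
    key u u' _ (continuous_classicalCurl hφ.contDiff)
      (hasCompactSupport_classicalCurl hφ.hasCompactSupport), h φ hφ, h' φ hφ]

theorem IsWeakCurl.smul {p : ℝ≥0∞} {Ω : Opens R3} {u w : LpField p Ω} (c : ℝ)
    (h : IsWeakCurl Ω u w) : IsWeakCurl Ω (c • u : LpField p Ω) (c • w : LpField p Ω) := by
  intro φ hφ
  have key : ∀ (a : LpField p Ω) (ψ : R3 → R3),
      ∫ x in (Ω : Set R3), ⟪(c • a : LpField p Ω) x, ψ x⟫_ℝ =
        c * ∫ x in (Ω : Set R3), ⟪a x, ψ x⟫_ℝ := by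
    intro a ψ
    rw [← integral_const_mul]
    refine integral_congr_ae ?_
    filter_upwards [Lp.coeFn_smul c a] with x hx
    rw [hx, Pi.smul_apply, real_inner_smul_left]
  rw [key w φ, key u _, h φ hφ]

theorem IsWeakCurl.zero {p : ℝ≥0∞} {Ω : Opens R3} :
    IsWeakCurl Ω (0 : LpField p Ω) (0 : LpField p Ω) := by
  intro φ _
  have key : ∀ ψ : R3 → R3, ∫ x in (Ω : Set R3), ⟪(0 : LpField p Ω) x, ψ x⟫_ℝ = 0 := by
    intro ψ
    refine integral_eq_zero_of_ae ?_
    filter_upwards [Lp.coeFn_zero R3 p (volume.restrict (Ω : Set R3))] with x hx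
    rw [hx, Pi.zero_apply, inner_zero_left, Pi.zero_apply]
  rw [key, key]

/-- The weak curl is unique. -/
theorem IsWeakCurl.unique {p : ℝ≥0∞} [hp : Fact (1 ≤ p)] {Ω : Opens R3} {u w w' : LpField p Ω}
    (h : IsWeakCurl Ω u w) (h' : IsWeakCurl Ω u w') : w = w' := by
  have hi : ∀ i : Fin 3, ∀ᵐ x ∂volume, x ∈ (Ω : Set R3) → w x i - w' x i = 0 := by
    intro i
    have hloc : ∀ a : LpField p Ω, LocallyIntegrableOn (fun x => a x i) (Ω : Set R3) volume := by
      intro a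
      have h1 : LocallyIntegrableOn a (Ω : Set R3) volume :=
        (locallyIntegrableOn_of_locallyIntegrable_restrict
          ((Lp.memLp a).locallyIntegrable hp.out))
      intro x hx
      obtain ⟨s, hs, his⟩ := h1 x hx
      exact ⟨s, hs, (EuclideanSpace.proj (𝕜 := ℝ) i).integrable_comp his⟩
    refine Ω.isOpen.ae_eq_zero_of_integral_contDiff_smul_eq_zero ((hloc w).sub (hloc w')) ?_
    intro g hg hgs hgt
    have hφ : IsTestField Ω (fun x => g x • EuclideanSpace.single i (1 : ℝ)) := by
      refine ⟨hg.smul contDiff_const, hgs.smul_right, ?_⟩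
      exact (closure_mono (Function.support_smul_subset_left g _)).trans hgt
    have e := (h _ hφ).trans (h' _ hφ).symm
    have i1 := integrable_inner_of_hasCompactSupport w hφ.contDiff.continuous hφ.hasCompactSupport
    have i2 := integrable_inner_of_hasCompactSupport w' hφ.contDiff.continuous hφ.hasCompactSupport
    have e2 := sub_eq_zero.mpr e
    rw [← integral_sub i1 i2] at e2
    rw [← setIntegral_eq_integral_of_forall_compl_eq_zero (s := (Ω : Set R3)), ← e2]
    · refine integral_congr_ae ?_
      filter_upwards with x
      simp [inner_smul_right, EuclideanSpace.inner_single_right, mul_sub]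
    · intro x hx
      have : g x = 0 := by
        by_contra hne
        exact hx (hgt (subset_tsupport g hne))
      simp [this]
  refine Lp.ext ?_
  rw [Filter.EventuallyEq, ae_restrict_iff' Ω.isOpen.measurableSet]
  filter_upwards [hi 0, hi 1, hi 2] with x h0 h1 h2 hx
  ext i
  fin_cases i
  · exact sub_eq_zero.mp (h0 hx)
  · exact sub_eq_zero.mp (h1 hx)
  · exact sub_eq_zero.mp (h2 hx)

/-- The vector fields in `L^p(Ω)³` whose distributional curl lies in `L^p(Ω)³`. -/
def wCurlSubmodule (p : ℝ≥0∞) [Fact (1 ≤ p)] (Ω : Opens R3) : Submodule ℝ (LpField p Ω) where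
  carrier := {u | ∃ w : LpField p Ω, IsWeakCurl Ω u w}
  add_mem' := fun ⟨w, hw⟩ ⟨w', hw'⟩ => ⟨w + w', hw.add hw'⟩
  zero_mem' := ⟨0, IsWeakCurl.zero⟩
  smul_mem' := fun c _ ⟨w, hw⟩ => ⟨c • w, hw.smul c⟩

/-- The space `W^p(curl; Ω)`. It is a new type, because its norm is not the one induced
from `L^p(Ω)³`. -/
def WCurl (p : ℝ≥0∞) [Fact (1 ≤ p)] (Ω : Opens R3) : Type := wCurlSubmodule p Ω

namespace WCurl

variable {p : ℝ≥0∞} [Fact (1 ≤ p)] {Ω : Opens R3}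

instance : AddCommGroup (WCurl p Ω) := inferInstanceAs (AddCommGroup (wCurlSubmodule p Ω))

instance : Module ℝ (WCurl p Ω) := inferInstanceAs (Module ℝ (wCurlSubmodule p Ω))

/-- The inclusion of `W^p(curl; Ω)` in `L^p(Ω)³`. -/
def toLp : WCurl p Ω →ₗ[ℝ] LpField p Ω := (wCurlSubmodule p Ω).subtype

theorem toLp_injective : Function.Injective (toLp : WCurl p Ω → LpField p Ω) :=
  Subtype.val_injective

theorem exists_isWeakCurl (u : WCurl p Ω) : ∃ w : LpField p Ω, IsWeakCurl Ω (toLp u) w := u.2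

/-- The distributional curl as a linear operator `W^p(curl; Ω) → L^p(Ω)³`. -/
def curl : WCurl p Ω →ₗ[ℝ] LpField p Ω where
  toFun u := (exists_isWeakCurl u).choose
  map_add' u v := by
    refine (exists_isWeakCurl (u + v)).choose_spec.unique ?_
    rw [map_add]
    exact (exists_isWeakCurl u).choose_spec.add (exists_isWeakCurl v).choose_spec
  map_smul' c u := by
    refine (exists_isWeakCurl (c • u)).choose_spec.unique ?_
    rw [map_smul]
    exact (exists_isWeakCurl u).choose_spec.smul c

theorem isWeakCurl_curl (u : WCurl p Ω) : IsWeakCurl Ω (toLp u) (curl u) :=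
  (exists_isWeakCurl u).choose_spec

/-- The norm `‖u‖ = ‖u‖_{L^p(Ω)} + ‖curl u‖_{L^p(Ω)}` of `W^p(curl; Ω)`. -/
instance : NormedAddCommGroup (WCurl p Ω) :=
  AddGroupNorm.toNormedAddCommGroup
    { toFun := fun u => ‖toLp u‖ + ‖curl u‖
      map_zero' := by simp
      add_le' := fun u v => by
        rw [map_add, map_add]
        linarith [norm_add_le (toLp u) (toLp v), norm_add_le (curl u) (curl v)]
      neg' := fun u => by simp
      eq_zero_of_map_eq_zero' := fun u hu => by
        have h0 : ‖toLp u‖ = 0 := by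
          linarith [norm_nonneg (toLp u), norm_nonneg (curl u)]
        exact toLp_injective (by rw [norm_eq_zero.mp h0, map_zero]) }

theorem norm_def (u : WCurl p Ω) : ‖u‖ = ‖toLp u‖ + ‖curl u‖ := rfl

instance : NormedSpace ℝ (WCurl p Ω) where
  norm_smul_le c u := by
    rw [norm_def, norm_def, map_smul, map_smul, norm_smul, norm_smul, mul_add]

/-- `u` is (the class of) the vector field `φ` on `Ω`. -/
def Represents (u : WCurl p Ω) (φ : R3 → R3) : Prop :=
  toLp u =ᵐ[volume.restrict (Ω : Set R3)] φ

end WCurl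

/-- `C^∞(Ω̄)³` as a subset of `W^p(curl; Ω)`: the classes of the restrictions to `Ω` of
smooth vector fields on `ℝ³`. -/
def smoothFields (p : ℝ≥0∞) [Fact (1 ≤ p)] (Ω : Opens R3) : Set (WCurl p Ω) :=
  {u | ∃ φ : R3 → R3, ContDiff ℝ ∞ φ ∧ u.Represents φ}

end

/-! A bounded Lipschitz set is covered, up to its boundary, by finitely many patches, each with a
cone of directions along which small displacements keep its points of `Ω` inside `Ω`
(`HasLipschitzBoundary.exists_cone`). Extend `u` and its weak curl `w` by zero to `U` and `W`. In
general `W` is not the weak curl of `U` across the boundary. However, if a mollifier is supported in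
the opposite of the cone, then for `x` in the patch the average `(η ⋆ U) x` only sees values of `u`
inside `Ω`, and there `curl (η ⋆ U) = η ⋆ W` (`IsWeakCurl.classicalCurl_convolution`).

With a partition of unity `χ i` subordinate to the patches and mollifiers `η i n`, put `v n = ∑ i, χ
i • (η i n ⋆ U)`. Its curl on `Ω` is `∑ i, χ i • (η i n ⋆ W) + ∑ i, ∇χ i × (η i n ⋆ U)`.
Mollification converges in `L^p` because translations are continuous there for `p < ∞`, so the first
sum tends to `w`. The second tends to `∑ i, ∇χ i × u`, which vanishes since `∑ i, χ i = 1` on the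
open set `Ω`.

Smooth fields lie in the space because `Ω` is bounded and integration by parts identifies their weak
curl. -/

open Filter Topology Convolution

/-! ### Mollification in `L^p` -/

section Mollification

variable {E F : Type*} [NormedAddCommGroup E] [NormedSpace ℝ E] [FiniteDimensional ℝ E]
  [MeasurableSpace E] [BorelSpace E] {μ : Measure E} [μ.IsAddHaarMeasure]
  [NormedAddCommGroup F] [NormedSpace ℝ F] {p : ℝ≥0∞}

/-- A smooth compactly supported probability density. -/
structure IsMollifier (η : E → ℝ) (μ : Measure E) : Prop where
  contDiff : ContDiff ℝ ∞ η
  hasCompactSupport : HasCompactSupport η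
  nonneg : ∀ x, 0 ≤ η x
  integral_eq_one : ∫ x, η x ∂μ = 1

/-- Minkowski's inequality for the error made by mollification. -/
theorem IsMollifier.eLpNorm_convolution_sub_le [CompleteSpace F] {η : E → ℝ}
    (hη : IsMollifier η μ) {f : E → F} (hp1 : 1 ≤ p) (hp : p ≠ ⊤) (hf : MemLp f p μ) {C : ℝ≥0∞}
    (hC : ∀ y ∈ Function.support η, eLpNorm (fun x => f (x - y) - f x) p μ ≤ C) :
    eLpNorm (η ⋆[ContinuousLinearMap.lsmul ℝ ℝ, μ] f - f) p μ ≤ C := by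
  have hp0 : p ≠ 0 := (zero_lt_one.trans_le hp1).ne'
  have hpr : 0 < p.toReal := ENNReal.toReal_pos hp0 hp
  have hmeas : Measurable fun y => ENNReal.ofReal (η y) :=
    hη.contDiff.continuous.measurable.ennreal_ofReal
  have hint : Integrable η μ :=
    hη.contDiff.continuous.integrable_of_hasCompactSupport hη.hasCompactSupport
  -- The error `η ⋆ f - f` at `x` is the mean of `f (x - y) - f x` under the probability measure `η
  -- dμ`. Monotonicity of `L^p` norms in `p` bounds its `p`-th power by the mean of `p`-th powers;
  -- Tonelli then finishes.
  set ν : Measure E := μ.withDensity fun y => ENNReal.ofReal (η y) with hν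
  have hνμ : ν ≪ μ := withDensity_absolutelyContinuous _ _
  have hprob : IsProbabilityMeasure ν := by
    refine ⟨?_⟩
    rw [hν, withDensity_apply _ MeasurableSet.univ, Measure.restrict_univ,
      ← ofReal_integral_eq_lintegral_ofReal hint (Eventually.of_forall hη.nonneg),
      hη.integral_eq_one, ENNReal.ofReal_one]
  have hfin : ∀ᵐ y ∂μ, ENNReal.ofReal (η y) < ⊤ := by simp
  have hsec : ∀ x, AEStronglyMeasurable (fun y => f (x - y) - f x) ν := fun x =>
    ((hf.1.comp_quasiMeasurePreserving (quasiMeasurePreserving_sub_left μ x)).sub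
      aestronglyMeasurable_const).mono_ac hνμ
  have hpt : ∀ x, ‖(η ⋆[ContinuousLinearMap.lsmul ℝ ℝ, μ] f - f) x‖ₑ ^ p.toReal ≤
      ∫⁻ y, ‖f (x - y) - f x‖ₑ ^ p.toReal ∂ν := by
    intro x
    have hex : Integrable (fun y => η y • f (x - y)) μ :=
      hη.hasCompactSupport.convolutionExists_left (ContinuousLinearMap.lsmul ℝ ℝ)
        hη.contDiff.continuous (hf.locallyIntegrable hp1) x
    have hexν : Integrable (fun y => f (x - y)) ν := by
      rw [hν, integrable_withDensity_iff_integrable_smul' hmeas hfin]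
      simpa only [ENNReal.toReal_ofReal (hη.nonneg _)] using hex
    have heq : (η ⋆[ContinuousLinearMap.lsmul ℝ ℝ, μ] f - f) x = ∫ y, (f (x - y) - f x) ∂ν := by
      rw [integral_sub hexν (integrable_const _), integral_const, probReal_univ, one_smul,
        Pi.sub_apply, convolution_lsmul, hν,
        integral_withDensity_eq_integral_toReal_smul hmeas hfin]
      simp only [ENNReal.toReal_ofReal (hη.nonneg _)]
    rw [heq]
    have h1 : ‖∫ y, (f (x - y) - f x) ∂ν‖ₑ ≤ eLpNorm (fun y => f (x - y) - f x) p ν :=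
      (enorm_integral_le_lintegral_enorm _).trans
        (eLpNorm_one_eq_lintegral_enorm.symm.trans_le
          (eLpNorm_le_eLpNorm_of_exponent_le hp1 (hsec x)))
    rw [eLpNorm_eq_lintegral_rpow_enorm_toReal hp0 hp] at h1
    refine (ENNReal.rpow_le_rpow h1 hpr.le).trans_eq ?_
    rw [← ENNReal.rpow_mul, one_div, inv_mul_cancel₀ hpr.ne', ENNReal.rpow_one]
  have hprod : AEMeasurable (Function.uncurry fun x y => ‖f (x - y) - f x‖ₑ ^ p.toReal)
      (μ.prod ν) := by
    have h2 : AEStronglyMeasurable (fun z : E × E => f (z.1 - z.2) - f z.1) (μ.prod ν) :=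
      (hf.1.comp_quasiMeasurePreserving (quasiMeasurePreserving_sub μ ν)).sub hf.1.comp_fst
    exact h2.enorm.pow_const _
  rw [eLpNorm_eq_lintegral_rpow_enorm_toReal hp0 hp, one_div, ENNReal.rpow_inv_le_iff hpr]
  calc ∫⁻ x, ‖(η ⋆[ContinuousLinearMap.lsmul ℝ ℝ, μ] f - f) x‖ₑ ^ p.toReal ∂μ
      ≤ ∫⁻ x, ∫⁻ y, ‖f (x - y) - f x‖ₑ ^ p.toReal ∂ν ∂μ := lintegral_mono hpt
    _ = ∫⁻ y, ∫⁻ x, ‖f (x - y) - f x‖ₑ ^ p.toReal ∂μ ∂ν := lintegral_lintegral_swap hprod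
    _ ≤ ∫⁻ _, C ^ p.toReal ∂ν := by
        refine lintegral_mono_ae ?_
        rw [hν, ae_withDensity_iff hmeas]
        refine Eventually.of_forall fun y hy => ?_
        have hy' : y ∈ Function.support η := fun h0 => hy (by simp [h0])
        have h3 := hC y hy'
        rwa [eLpNorm_eq_lintegral_rpow_enorm_toReal hp0 hp, one_div,
          ENNReal.rpow_inv_le_iff hpr] at h3
    _ = C ^ p.toReal := by simp

/-- Translation is continuous in `L^p` for `p < ∞`. -/
theorem MeasureTheory.MemLp.eventually_eLpNorm_translate_sub_le {G : Type*}
    [NormedAddCommGroup G] {f : E → G} (hp1 : 1 ≤ p)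
    (hp : p ≠ ⊤) (hf : MemLp f p μ) {ε : ℝ≥0∞} (hε : ε ≠ 0) :
    ∀ᶠ y in 𝓝 (0 : E), eLpNorm (fun x => f (x - y) - f x) p μ ≤ ε := by
  have : Fact (1 ≤ p) := ⟨hp1⟩
  have : Fact (p ≠ ⊤) := ⟨hp⟩
  -- Translation by `y` is the action of `-y` on the domain, which is continuous on `L^p` for finite
  -- `p`.
  have hcont : Continuous fun y : E => DomAddAct.mk (-y) +ᵥ hf.toLp f :=
    (DomAddAct.continuous_mk.comp continuous_neg).vadd continuous_const
  have ht := hcont.tendsto 0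
  have h0 : DomAddAct.mk (-(0 : E)) +ᵥ hf.toLp f = hf.toLp f := by
    rw [neg_zero, DomAddAct.mk_zero, zero_vadd]
  rw [h0, EMetric.tendsto_nhds] at ht
  filter_upwards [ht ε (pos_iff_ne_zero.mpr hε)] with y hy
  rw [DomAddAct.mk_vadd_toLp, Lp.edist_toLp_toLp] at hy
  refine le_trans (le_of_eq ?_) hy.le
  congr 1
  ext x
  simp [sub_eq_neg_add]

/-- Mollification with shrinking supports converges in `L^p` for `p < ∞`. -/
theorem tendsto_eLpNorm_convolution_sub [CompleteSpace F] {ι : Type*} {l : Filter ι}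
    {η : ι → E → ℝ} (hη : ∀ n, IsMollifier (η n) μ)
    (hsupp : Tendsto (fun n => Function.support (η n)) l (𝓝 0).smallSets)
    {f : E → F} (hp1 : 1 ≤ p) (hp : p ≠ ⊤) (hf : MemLp f p μ) :
    Tendsto (fun n => eLpNorm (η n ⋆[ContinuousLinearMap.lsmul ℝ ℝ, μ] f - f) p μ) l (𝓝 0) := by
  rw [ENNReal.tendsto_nhds_zero]
  intro ε hε
  have h1 := hf.eventually_eLpNorm_translate_sub_le hp1 hp hε.ne'
  filter_upwards [tendsto_smallSets_iff.mp hsupp _ h1] with n hn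
  exact (hη n).eLpNorm_convolution_sub_le hp1 hp hf fun y hy => hn hy

end Mollification

/-! ### Algebra of the curl and integration by parts -/

noncomputable section

/-- The curl as a function of the Jacobian. -/
def curlOfJacobian : (R3 →L[ℝ] R3) →L[ℝ] R3 :=
  LinearMap.toContinuousLinearMap
    { toFun := fun A =>
        !₂[A (EuclideanSpace.single 1 1) 2 - A (EuclideanSpace.single 2 1) 1,
           A (EuclideanSpace.single 2 1) 0 - A (EuclideanSpace.single 0 1) 2,
           A (EuclideanSpace.single 0 1) 1 - A (EuclideanSpace.single 1 1) 0]
      map_add' := fun A B => by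
        ext i
        fin_cases i <;> simp <;> ring
      map_smul' := fun c A => by
        ext i
        fin_cases i <;> simp <;> ring }

theorem classicalCurl_eq (φ : R3 → R3) (x : R3) :
    classicalCurl φ x = curlOfJacobian (fderiv ℝ φ x) := rfl

/-- The Jacobian `l ⊗ v` has curl `l × v`, so this is the antisymmetry of the triple product. -/
theorem inner_curlOfJacobian_smulRight (l : R3 →L[ℝ] ℝ) (u v : R3) :
    ⟪u, curlOfJacobian (l.smulRight v)⟫_ℝ = -⟪curlOfJacobian (l.smulRight u), v⟫_ℝ := by
  simp [curlOfJacobian, PiLp.inner_apply, Fin.sum_univ_three]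
  ring

theorem norm_curlOfJacobian_smulRight_le (l : R3 →L[ℝ] ℝ) (a : R3) :
    ‖curlOfJacobian (l.smulRight a)‖ ≤ ‖curlOfJacobian‖ * ‖l‖ * ‖a‖ := by
  refine (curlOfJacobian.le_opNorm _).trans_eq ?_
  rw [ContinuousLinearMap.norm_smulRight_apply, mul_assoc]

/-- The cross product with the `i`-th basis vector. -/
def basisCross (i : Fin 3) : R3 →L[ℝ] R3 :=
  curlOfJacobian ∘L ContinuousLinearMap.smulRightL ℝ R3 R3 (EuclideanSpace.proj i)

theorem basisCross_apply (i : Fin 3) (a : R3) :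
    basisCross i a = curlOfJacobian ((EuclideanSpace.proj i : R3 →L[ℝ] ℝ).smulRight a) := rfl

theorem inner_basisCross_right (i : Fin 3) (a b : R3) :
    ⟪a, basisCross i b⟫_ℝ = -⟪basisCross i a, b⟫_ℝ :=
  inner_curlOfJacobian_smulRight _ _ _

/-- Since `A = ∑ i, proj i ⊗ A eᵢ`, the curl is `∑ i, eᵢ × ∂ᵢ`, a form suited to integrating by
parts one coordinate at a time. -/
theorem curlOfJacobian_eq_sum (A : R3 →L[ℝ] R3) :
    curlOfJacobian A = ∑ i, basisCross i (A (EuclideanSpace.single i 1)) := by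
  simp only [basisCross_apply, ← map_sum]
  congr 1
  ext x : 1
  have hx : x = ∑ i, x i • EuclideanSpace.single i (1 : ℝ) := by
    ext j
    fin_cases j <;> simp [Fin.sum_univ_three]
  conv_lhs => rw [hx]
  simp [map_sum]

theorem classicalCurl_smul {χ : R3 → ℝ} {g : R3 → R3} {x : R3} (hχ : DifferentiableAt ℝ χ x)
    (hg : DifferentiableAt ℝ g x) :
    classicalCurl (fun y => χ y • g y) x =
      χ x • classicalCurl g x + curlOfJacobian ((fderiv ℝ χ x).smulRight (g x)) := by
  rw [classicalCurl_eq, classicalCurl_eq, fderiv_fun_smul hχ hg, map_add, map_smul]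

theorem classicalCurl_sum {ι : Type*} {s : Finset ι} {g : ι → R3 → R3} {x : R3}
    (hg : ∀ i ∈ s, DifferentiableAt ℝ (g i) x) :
    classicalCurl (fun y => ∑ i ∈ s, g i y) x = ∑ i ∈ s, classicalCurl (g i) x := by
  simp only [classicalCurl_eq, fderiv_fun_sum hg, map_sum]

/-- For smooth fields the classical curl is the distributional one. -/
theorem isWeakCurl_classicalCurl (Ω : Opens R3) {ψ : R3 → R3} (hψ : ContDiff ℝ ∞ ψ) :
    IsWeakCurl Ω ψ (classicalCurl ψ) := by
  intro φ hφ
  have hψ1 : Continuous (fderiv ℝ ψ) := hψ.continuous_fderiv (by simp)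
  have hφ1 : Continuous (fderiv ℝ φ) := hφ.contDiff.continuous_fderiv (by simp)
  have hφ0 : ∀ x, x ∉ (Ω : Set R3) → φ x = 0 := fun x hx => by
    by_contra h0
    exact hx (hφ.tsupport_subset (subset_tsupport φ h0))
  have hφ2 : ∀ x, x ∉ (Ω : Set R3) → classicalCurl φ x = 0 := fun x hx => by
    have h0 : x ∉ tsupport (fderiv ℝ φ) := fun h =>
      hx (hφ.tsupport_subset (tsupport_fderiv_subset ℝ h))
    rw [classicalCurl_eq, image_eq_zero_of_notMem_tsupport h0, map_zero]
  rw [setIntegral_eq_integral_of_forall_compl_eq_zero fun x hx => by rw [hφ0 x hx, inner_zero_right],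
    setIntegral_eq_integral_of_forall_compl_eq_zero fun x hx => by rw [hφ2 x hx, inner_zero_right]]
  -- `B i a b = ⟪eᵢ × a, b⟫`. The sign from integrating by parts cancels the one from moving `eᵢ ×`
  -- to the other factor.
  let B : Fin 3 → R3 →L[ℝ] R3 →L[ℝ] ℝ := fun i => innerSL ℝ ∘L basisCross i
  have hφc := hφ.hasCompactSupport
  have hφc1 : HasCompactSupport (fderiv ℝ φ) := hφc.fderiv ℝ
  have hi1 : ∀ i, Integrable (fun x => B i (fderiv ℝ ψ x (EuclideanSpace.single i 1)) (φ x)) := by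
    intro i
    refine Continuous.integrable_of_hasCompactSupport ?_ (hφc.mono fun x hx h0 => hx ?_)
    · have := hφ.contDiff.continuous
      fun_prop
    · simp only [h0, map_zero]
  have hi2 : ∀ i, Integrable (fun x => B i (ψ x) (fderiv ℝ φ x (EuclideanSpace.single i 1))) := by
    intro i
    refine Continuous.integrable_of_hasCompactSupport ?_ (hφc1.mono fun x hx h0 => hx ?_)
    · have := hψ.continuous
      fun_prop
    · simp only [h0, zero_apply, map_zero]
  have hi3 : ∀ i, Integrable (fun x => B i (ψ x) (φ x)) := by
    intro i
    refine Continuous.integrable_of_hasCompactSupport ?_ (hφc.mono fun x hx h0 => hx ?_)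
    · have := hψ.continuous
      have := hφ.contDiff.continuous
      fun_prop
    · simp only [h0, map_zero]
  have hparts : ∀ i, ∫ x, B i (fderiv ℝ ψ x (EuclideanSpace.single i 1)) (φ x) =
      -∫ x, B i (ψ x) (fderiv ℝ φ x (EuclideanSpace.single i 1)) := fun i => by
    rw [integral_bilinear_fderiv_right_eq_neg_left_of_integrable (hi1 i) (hi2 i) (hi3 i)
      (fun x _ => hψ.differentiable (by simp) x)
      (fun x _ => hφ.contDiff.differentiable (by simp) x), neg_neg]
  calc ∫ x, ⟪classicalCurl ψ x, φ x⟫_ℝ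
      = ∫ x, ∑ i, B i (fderiv ℝ ψ x (EuclideanSpace.single i 1)) (φ x) := by
        simp only [classicalCurl_eq, curlOfJacobian_eq_sum, sum_inner]
        rfl
    _ = ∑ i, -∫ x, B i (ψ x) (fderiv ℝ φ x (EuclideanSpace.single i 1)) := by
        rw [integral_finsetSum _ fun i _ => hi1 i]
        simp only [hparts]
    _ = ∫ x, ∑ i, -B i (ψ x) (fderiv ℝ φ x (EuclideanSpace.single i 1)) := by
        rw [integral_finsetSum _ fun i _ => by exact (hi2 i).neg]
        simp only [integral_neg]
    _ = ∫ x, ⟪ψ x, classicalCurl φ x⟫_ℝ := by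
        simp only [classicalCurl_eq, curlOfJacobian_eq_sum, inner_sum, inner_basisCross_right]
        rfl

/-! ### The curl of a mollified field -/

section Convolution

variable {η : R3 → ℝ} {f : R3 → R3}

theorem inner_convolution (hη : ContDiff ℝ ∞ η) (hc : HasCompactSupport η)
    (hf : LocallyIntegrable f) (x v : R3) :
    ⟪(η ⋆[ContinuousLinearMap.lsmul ℝ ℝ, volume] f) x, v⟫_ℝ =
      ∫ y, ⟪f y, η (x - y) • v⟫_ℝ := by
  have hex : Integrable (fun y => η y • f (x - y)) :=
    hc.convolutionExists_left (ContinuousLinearMap.lsmul ℝ ℝ) hη.continuous hf x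
  rw [convolution_lsmul, real_inner_comm, ← integral_inner hex,
    ← integral_sub_left_eq_self (fun y => ⟪f y, η (x - y) • v⟫_ℝ) volume x]
  congr 1 with y
  rw [sub_sub_cancel, inner_smul_right, inner_smul_right, real_inner_comm]

/-- The derivative falls on `η`, so local integrability of `f` is enough. Differentiating `η (x -
y)` in `y` gives a sign that the triple product cancels. -/
theorem inner_classicalCurl_convolution (hη : ContDiff ℝ ∞ η) (hc : HasCompactSupport η)
    (hf : LocallyIntegrable f) (x v : R3) :
    ⟪classicalCurl (η ⋆[ContinuousLinearMap.lsmul ℝ ℝ, volume] f) x, v⟫_ℝ =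
      ∫ y, ⟪f y, classicalCurl (fun y => η (x - y) • v) y⟫_ℝ := by
  have hη1 : Continuous (fderiv ℝ η) := hη.continuous_fderiv (by simp)
  have hex : Integrable (fun y => (fderiv ℝ η y).smulRight (f (x - y))) :=
    (hc.fderiv ℝ).convolutionExists_left
      (ContinuousLinearMap.precompL R3 (ContinuousLinearMap.lsmul ℝ ℝ : ℝ →L[ℝ] R3 →L[ℝ] R3))
      hη1 hf x
  have hd : fderiv ℝ (η ⋆[ContinuousLinearMap.lsmul ℝ ℝ, volume] f) x =
      ∫ y, (fderiv ℝ η y).smulRight (f (x - y)) :=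
    (hc.hasFDerivAt_convolution_left _ (hη.of_le (by simp)) hf x).fderiv
  have hcurl : ∀ y, classicalCurl (fun y => η (x - y) • v) y =
      -curlOfJacobian ((fderiv ℝ η (x - y)).smulRight v) := by
    intro y
    have h1 : HasFDerivAt (fun y => η (x - y)) (-fderiv ℝ η (x - y)) y := by
      have h2 := ((hη.differentiable (by simp)) (x - y)).hasFDerivAt.comp y
        ((hasFDerivAt_id y).const_sub x)
      refine h2.congr_fderiv ?_
      ext z
      simp
    rw [classicalCurl_eq, (h1.smul_const v).fderiv, ← map_neg]
    congr 1
    ext z : 1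
    simp
  rw [classicalCurl_eq, hd, ← curlOfJacobian.integral_comp_comm hex, real_inner_comm,
    ← integral_inner (curlOfJacobian.integrable_comp hex),
    ← integral_sub_left_eq_self (fun y => ⟪f y, classicalCurl (fun y => η (x - y) • v) y⟫_ℝ)
      volume x]
  congr 1 with y
  rw [hcurl, sub_sub_cancel, inner_neg_right, real_inner_comm,
    inner_curlOfJacobian_smulRight, neg_neg]

/-- Mollification commutes with the curl at points whose mollification window lies in `Ω`. -/
theorem IsWeakCurl.classicalCurl_convolution {Ω : Opens R3} {u w : R3 → R3}
    (h : IsWeakCurl Ω u w) (hη : ContDiff ℝ ∞ η) (hc : HasCompactSupport η)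
    (hu : LocallyIntegrable ((Ω : Set R3).indicator u))
    (hw : LocallyIntegrable ((Ω : Set R3).indicator w)) {x : R3}
    (hx : ∀ y ∈ tsupport η, x - y ∈ Ω) :
    classicalCurl (η ⋆[ContinuousLinearMap.lsmul ℝ ℝ, volume] (Ω : Set R3).indicator u) x =
      (η ⋆[ContinuousLinearMap.lsmul ℝ ℝ, volume] (Ω : Set R3).indicator w) x := by
  refine ext_inner_right ℝ fun v => ?_
  rw [inner_classicalCurl_convolution hη hc hu, inner_convolution hη hc hw]
  have hsub : HasCompactSupport fun y => η (x - y) :=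
    hc.comp_homeomorph (Homeomorph.subLeft x)
  -- The window condition `hx` makes the reflected kernel an admissible test field, to which the
  -- definition of the weak curl applies.
  have htest : IsTestField Ω fun y => η (x - y) • v := by
    refine ⟨(hη.comp (contDiff_const.sub contDiff_id)).smul contDiff_const, hsub.smul_right, ?_⟩
    refine (closure_mono (Function.support_smul_subset_left (fun y => η (x - y)) fun _ => v)).trans fun y hy => ?_
    have h1 : x - y ∈ tsupport η :=
      tsupport_comp_subset_preimage η (continuous_const.sub continuous_id) hy
    simpa using hx _ h1
  have hind : ∀ a b : R3 → R3, ∫ y, ⟪(Ω : Set R3).indicator a y, b y⟫_ℝ =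
      ∫ y in (Ω : Set R3), ⟪a y, b y⟫_ℝ := fun a b => by
    rw [← integral_indicator Ω.isOpen.measurableSet]
    congr 1 with y
    by_cases hy : y ∈ (Ω : Set R3) <;> simp [hy]
  rw [hind, hind, h _ htest]

end Convolution

end

/-! ### Cones, adapted mollifiers and the partition of unity -/

theorem norm_take_two_le (c : R3) : ‖!₂[c 0, c 1]‖ ≤ ‖c‖ := by
  rw [EuclideanSpace.norm_eq, EuclideanSpace.norm_eq]
  refine Real.sqrt_le_sqrt ?_
  simp [Fin.sum_univ_two, Fin.sum_univ_three]
  positivity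

/-- A Lipschitz epigraph is stable under small displacements in a cone of upward directions. -/
theorem epigraph_add_smul_mem {K : NNReal} {h : EuclideanSpace ℝ (Fin 2) → ℝ}
    (hh : LipschitzWith K h) {c d : R3} (hc : h !₂[c 0, c 1] < c 2)
    (hd : ‖d - EuclideanSpace.single 2 1‖ ≤ 1 / (K + 1)) {t : ℝ} (ht : 0 ≤ t) :
    h !₂[(c + t • d) 0, (c + t • d) 1] < (c + t • d) 2 := by
  -- This radius solves `K * r = 1 - r`: the graph rises by at most `K * (t * r)`, while the point
  -- rises by at least `t * (1 - r)`.
  set r : ℝ := 1 / (K + 1)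
  have hK : (K : ℝ) * r + r = 1 := by
    have : (K : ℝ) + 1 ≠ 0 := by positivity
    simp only [r]
    field_simp
  have h2 : 1 - r ≤ d 2 := by
    have h3 := (PiLp.norm_apply_le (d - EuclideanSpace.single 2 1) 2).trans hd
    simp [Real.norm_eq_abs] at h3
    linarith [(abs_le.mp h3).1]
  have h01 : ‖!₂[d 0, d 1]‖ ≤ r := by
    refine le_trans (le_of_eq ?_) ((norm_take_two_le (d - EuclideanSpace.single 2 1)).trans hd)
    simp
  have hdist := hh.dist_le_mul !₂[(c + t • d) 0, (c + t • d) 1] !₂[c 0, c 1]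
  have hsub : !₂[(c + t • d) 0, (c + t • d) 1] - !₂[c 0, c 1] = t • !₂[d 0, d 1] := by
    ext i
    fin_cases i <;> simp
  rw [dist_eq_norm, dist_eq_norm, hsub, norm_smul, Real.norm_of_nonneg ht, Real.norm_eq_abs] at hdist
  have h4 := (abs_le.mp hdist).2
  have h5 : (K : ℝ) * (t * ‖!₂[d 0, d 1]‖) ≤ K * (t * r) := by gcongr
  have h6 : t * (1 - r) ≤ t * d 2 := by gcongr
  have h7 : (c + t • d) 2 = c 2 + t * d 2 := by simp
  rw [h7]
  have h8 : t * (1 - r) = K * (t * r) := by linear_combination (-t) * hK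
  linarith

/-- Near every point of its closure, a Lipschitz open set is stable under small displacements in a
fixed cone of directions. -/
theorem HasLipschitzBoundary.exists_cone {Ω : Set R3} (hΩ : IsOpen Ω)
    (hLip : HasLipschitzBoundary Ω) {z : R3} (hz : z ∈ closure Ω) :
    ∃ U : Set R3, IsOpen U ∧ z ∈ U ∧ ∃ (a : R3) (r T : ℝ), 0 < r ∧ 0 < T ∧
      ∀ x ∈ Ω ∩ U, ∀ t ∈ Set.Ioo 0 T, ∀ b ∈ Metric.closedBall a r, x + t • b ∈ Ω := by
  have key : ∀ (V : Set R3) (a : R3) (r : ℝ), V ∈ 𝓝 z → 0 < r →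
      (∀ x ∈ Ω ∩ V, ∀ t > (0 : ℝ), ∀ b ∈ Metric.closedBall a r, x + t • b ∈ V → x + t • b ∈ Ω) →
      ∃ U : Set R3, IsOpen U ∧ z ∈ U ∧ ∃ (a : R3) (r T : ℝ), 0 < r ∧ 0 < T ∧
        ∀ x ∈ Ω ∩ U, ∀ t ∈ Set.Ioo 0 T, ∀ b ∈ Metric.closedBall a r, x + t • b ∈ Ω := by
    intro V a r hV hr hmem
    obtain ⟨ε, hε, hεV⟩ := Metric.mem_nhds_iff.mp hV
    have hM : 0 < ‖a‖ + r := by positivity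
    -- Halving the ball and bounding `t` by `ε / 2 / (‖a‖ + r)` keeps `x + t • b` in `V`, where the
    -- local description is available.
    refine ⟨Metric.ball z (ε / 2), Metric.isOpen_ball, Metric.mem_ball_self (by positivity), a, r,
      ε / 2 / (‖a‖ + r), hr, by positivity, fun x hx t ht b hb => ?_⟩
    have hb1 : ‖b‖ ≤ ‖a‖ + r := by
      have := norm_le_norm_add_norm_sub' b a
      rw [mem_closedBall_iff_norm] at hb
      linarith
    have hx1 := mem_ball_iff_norm.mp hx.2
    have h1 : ‖t • b‖ < ε / 2 := by
      rw [norm_smul, Real.norm_of_nonneg ht.1.le]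
      calc t * ‖b‖ ≤ t * (‖a‖ + r) := by gcongr; exact ht.1.le
        _ < ε / 2 := (lt_div_iff₀ hM).mp ht.2
    refine hmem x ⟨hx.1, hεV (Metric.ball_subset_ball (by linarith) hx.2)⟩ t ht.1 b hb
      (hεV (mem_ball_iff_norm.mpr ?_))
    have h2 : x + t • b - z = (x - z) + t • b := by abel
    rw [h2]
    linarith [norm_add_le (x - z) (t • b)]
  by_cases hzΩ : z ∈ Ω
  · exact key Ω 0 1 (hΩ.mem_nhds hzΩ) one_pos fun _ _ _ _ _ _ h => h
  · obtain ⟨V, hVo, hzV, e, K, h, hh, hV⟩ := hLip z ⟨hz, by rwa [hΩ.interior_eq]⟩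
    -- The axis of the cone is the vertical direction of the local coordinates.
    refine key V (e.symm (EuclideanSpace.single 2 1)) (1 / (K + 1)) (hVo.mem_nhds hzV)
      (by positivity) fun x hx t ht b hb hbV => (hV _ hbV).mpr ?_
    rw [map_add, map_smul]
    refine epigraph_add_smul_mem hh ((hV x hx.2).mp hx.1) ?_ ht.le
    rw [mem_closedBall_iff_norm] at hb
    rwa [← e.apply_symm_apply (EuclideanSpace.single 2 1), ← map_sub, e.norm_map]

/-- Mollifiers concentrated on the opposite of a cone of directions. -/
theorem exists_isMollifier_tsupport_subset (a : R3) {r T : ℝ} (hr : 0 < r) (hT : 0 < T) :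
    ∃ η : ℕ → R3 → ℝ, (∀ n, IsMollifier (η n) volume) ∧
      Tendsto (fun n => Function.support (η n)) atTop (𝓝 0).smallSets ∧
      ∀ n, ∀ y ∈ tsupport (η n), ∃ t ∈ Set.Ioo 0 T, ∃ b ∈ Metric.closedBall a r, y = -(t • b) := by
  let t : ℕ → ℝ := fun n => T * (1 / ((n : ℝ) + 1)) / 2
  have ht : ∀ n, t n ∈ Set.Ioo 0 T := by
    intro n
    have h1 : 1 / ((n : ℝ) + 1) ≤ 1 := by
      rw [div_le_one (by positivity)]
      linarith [n.cast_nonneg (α := ℝ)]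
    refine ⟨by positivity, ?_⟩
    have : T * (1 / ((n : ℝ) + 1)) ≤ T := by nlinarith
    simp only [t]
    linarith
  have ht0 : Tendsto t atTop (𝓝 0) := by
    have := (tendsto_one_div_add_atTop_nhds_zero_nat (𝕜 := ℝ)).const_mul T |>.div_const 2
    simpa [t] using this
  -- The closed support is `-(t n • closedBall a r)`; the sign is there because convolution samples
  -- at `x - y`.
  let f : ∀ n, ContDiffBump (-(t n • a)) := fun n =>
    ⟨t n * r / 2, t n * r, by have := (ht n).1; positivity, by
      have := mul_pos (ht n).1 hr; linarith⟩
  have hsupp : ∀ n, ∀ y ∈ tsupport ((f n).normed volume),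
      ∃ b ∈ Metric.closedBall a r, y = -(t n • b) := by
    intro n y hy
    have htn := (ht n).1
    rw [(f n).tsupport_normed_eq, mem_closedBall_iff_norm] at hy
    refine ⟨-((t n)⁻¹ • y), ?_, by rw [smul_neg, smul_inv_smul₀ htn.ne', neg_neg]⟩
    have h1 : -((t n)⁻¹ • y) - a = -((t n)⁻¹ • (y - -(t n • a))) := by
      rw [sub_neg_eq_add, smul_add, inv_smul_smul₀ htn.ne', neg_add, sub_eq_add_neg]
    rw [mem_closedBall_iff_norm, h1, norm_neg, norm_smul, norm_inv, Real.norm_of_nonneg htn.le,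
      inv_mul_le_iff₀ htn]
    exact hy
  refine ⟨fun n => (f n).normed volume, fun n => ⟨(f n).contDiff_normed,
    (f n).hasCompactSupport_normed, (f n).nonneg_normed, (f n).integral_normed⟩, ?_, ?_⟩
  · refine tendsto_smallSets_iff.mpr fun s hs => ?_
    obtain ⟨ε, hε, hεs⟩ := Metric.mem_nhds_iff.mp hs
    have h1 : Tendsto (fun n => t n * (‖a‖ + r)) atTop (𝓝 0) := by
      simpa using ht0.mul_const (‖a‖ + r)
    filter_upwards [h1.eventually_lt_const hε] with n hn y hy
    obtain ⟨b, hb, rfl⟩ := hsupp n y (subset_tsupport _ hy)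
    refine hεs (mem_ball_zero_iff.mpr (lt_of_le_of_lt ?_ hn))
    have hb1 := norm_le_norm_add_norm_sub' b a
    rw [mem_closedBall_iff_norm] at hb
    rw [norm_neg, norm_smul, Real.norm_of_nonneg (ht n).1.le]
    have := (ht n).1
    gcongr
    linarith
  · intro n y hy
    exact ⟨t n, ht n, hsupp n y hy⟩

/-- A smooth partition of unity on the closure of a bounded Lipschitz open set, together with
mollifiers whose windows based at points of the `i`-th patch stay inside the set. -/
theorem HasLipschitzBoundary.exists_partition_mollifier {Ω : Set R3} (hΩ : IsOpen Ω)
    (hbdd : Bornology.IsBounded Ω) (hLip : HasLipschitzBoundary Ω) :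
    ∃ (ι : Type) (_ : Fintype ι) (χ : ι → R3 → ℝ) (η : ι → ℕ → R3 → ℝ),
      (∀ i, ContDiff ℝ ∞ (χ i)) ∧ (∀ x ∈ Ω, ∑ i, χ i x = 1) ∧
      (∀ i n, IsMollifier (η i n) volume) ∧
      (∀ i, Tendsto (fun n => Function.support (η i n)) atTop (𝓝 0).smallSets) ∧
      ∀ i n, ∀ x ∈ Ω, x ∈ tsupport (χ i) → ∀ y ∈ tsupport (η i n), x - y ∈ Ω := by
  have hloc : ∀ z : R3, ∃ U : Set R3, IsOpen U ∧ (z ∈ closure Ω → z ∈ U) ∧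
      ∃ η : ℕ → R3 → ℝ, (∀ n, IsMollifier (η n) volume) ∧
        Tendsto (fun n => Function.support (η n)) atTop (𝓝 0).smallSets ∧
        ∀ n, ∀ x ∈ Ω, x ∈ U → ∀ y ∈ tsupport (η n), x - y ∈ Ω := by
    intro z
    by_cases hz : z ∈ closure Ω
    · obtain ⟨U, hU, hzU, a, r, T, hr, hT, hcone⟩ := hLip.exists_cone hΩ hz
      obtain ⟨η, hη, hs, hsub⟩ := exists_isMollifier_tsupport_subset a hr hT
      refine ⟨U, hU, fun _ => hzU, η, hη, hs, fun n x hx hxU y hy => ?_⟩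
      obtain ⟨t, ht, b, hb, rfl⟩ := hsub n y hy
      rw [sub_neg_eq_add]
      exact hcone x ⟨hx, hxU⟩ t ht b hb
    -- Away from the closure the patch is empty and any mollifiers serve as default values.
    · obtain ⟨η, hη, hs, -⟩ := exists_isMollifier_tsupport_subset 0 one_pos one_pos
      exact ⟨∅, isOpen_empty, fun h => absurd h hz, η, hη, hs, fun n x _ hx => absurd hx (by simp)⟩
  choose U hU hzU η hη hs hsub using hloc
  have hcpt : IsCompact (closure Ω) := hbdd.isCompact_closure
  obtain ⟨t, ht⟩ := hcpt.elim_nhds_subcover' (fun z _ => U z)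
    fun z hz => (hU z).mem_nhds (hzU z hz)
  obtain ⟨χ, hχ⟩ := SmoothPartitionOfUnity.exists_isSubordinate (ι := t)
    (modelWithCornersSelf ℝ R3) isClosed_closure (fun i => U (i : closure Ω))
    (fun i => hU _) (ht.trans fun x hx => by simpa using hx)
  refine ⟨t, inferInstance, fun i => χ i, fun i => η (i : closure Ω), fun i => ?_, fun x hx => ?_,
    fun i n => hη _ n, fun i => hs _, fun i n x hx hxχ => hsub _ n x hx (hχ i hxχ)⟩
  · exact contMDiff_iff_contDiff.mp (χ i).contMDiff
  · rw [← finsum_eq_sum_of_fintype]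
    exact χ.sum_eq_one (subset_closure hx)

/-! ### Smooth fields in `W^p(curl; Ω)` -/

section SmoothFields

variable {p : ℝ≥0∞} {Ω : Opens R3}

theorem Continuous.memLp_restrict_of_isBounded {φ : R3 → R3} (hφ : Continuous φ)
    (hbdd : Bornology.IsBounded (Ω : Set R3)) (p : ℝ≥0∞) :
    MemLp φ p (volume.restrict (Ω : Set R3)) := by
  obtain ⟨C, hC⟩ := hbdd.isCompact_closure.exists_bound_of_continuousOn hφ.continuousOn
  have : IsFiniteMeasure (volume.restrict (Ω : Set R3)) :=
    isFiniteMeasure_restrict.mpr hbdd.measure_lt_top.ne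
  refine MemLp.of_bound hφ.aestronglyMeasurable C ?_
  filter_upwards [ae_restrict_mem Ω.isOpen.measurableSet] with x hx
  exact hC x (subset_closure hx)

theorem IsWeakCurl.congr_ae {u u' w w' : R3 → R3} (h : IsWeakCurl Ω u w)
    (hu : u' =ᵐ[volume.restrict (Ω : Set R3)] u) (hw : w' =ᵐ[volume.restrict (Ω : Set R3)] w) :
    IsWeakCurl Ω u' w' := by
  intro φ hφ
  have e1 : ∫ x in (Ω : Set R3), ⟪w' x, φ x⟫_ℝ = ∫ x in (Ω : Set R3), ⟪w x, φ x⟫_ℝ :=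
    integral_congr_ae (by filter_upwards [hw] with x hx; rw [hx])
  have e2 : ∫ x in (Ω : Set R3), ⟪u' x, classicalCurl φ x⟫_ℝ =
      ∫ x in (Ω : Set R3), ⟪u x, classicalCurl φ x⟫_ℝ :=
    integral_congr_ae (by filter_upwards [hu] with x hx; rw [hx])
  rw [e1, e2, h φ hφ]

/-- Smooth fields belong to `W^p(curl; Ω)`, with the classical curl. -/
theorem WCurl.exists_represents [Fact (1 ≤ p)] (hbdd : Bornology.IsBounded (Ω : Set R3))
    {φ : R3 → R3} (hφ : ContDiff ℝ ∞ φ) :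
    ∃ u : WCurl p Ω, u.Represents φ ∧
      curl u =ᵐ[volume.restrict (Ω : Set R3)] classicalCurl φ := by
  have hm := hφ.continuous.memLp_restrict_of_isBounded hbdd p
  have hm' := (continuous_classicalCurl hφ).memLp_restrict_of_isBounded hbdd p
  have hcurl : IsWeakCurl Ω (hm.toLp φ) (hm'.toLp (classicalCurl φ)) :=
    (isWeakCurl_classicalCurl Ω hφ).congr_ae hm.coeFn_toLp hm'.coeFn_toLp
  let u : WCurl p Ω := ⟨hm.toLp φ, hm'.toLp (classicalCurl φ), hcurl⟩
  have hu : curl u = hm'.toLp (classicalCurl φ) := (isWeakCurl_curl u).unique hcurl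
  exact ⟨u, hm.coeFn_toLp, hu ▸ hm'.coeFn_toLp⟩

end SmoothFields

/-! ### Stability of `L^p` limits -/

section Limits

variable {α β : Type*} {m : MeasurableSpace α} {μ : Measure α} {F G : Type*}
  [NormedAddCommGroup F] [NormedAddCommGroup G] {p : ℝ≥0∞} {l : Filter β}

theorem tendsto_eLpNorm_restrict_of_norm_le {s : Set α} (hs : MeasurableSet s) {f : β → α → F}
    {g : β → α → G} (C : ℝ) (hfg : ∀ n, ∀ x ∈ s, ‖f n x‖ ≤ C * ‖g n x‖)
    (hg : Tendsto (fun n => eLpNorm (g n) p μ) l (𝓝 0)) :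
    Tendsto (fun n => eLpNorm (f n) p (μ.restrict s)) l (𝓝 0) := by
  have h1 : Tendsto (fun n => ENNReal.ofReal C * eLpNorm (g n) p μ) l (𝓝 0) := by
    simpa using ENNReal.Tendsto.const_mul hg (Or.inr ENNReal.ofReal_ne_top)
  refine tendsto_of_tendsto_of_tendsto_of_le_of_le tendsto_const_nhds h1 (fun _ => zero_le) fun n => ?_
  refine (eLpNorm_le_mul_eLpNorm_of_ae_le_mul ?_ p).trans
    (mul_le_mul_right (eLpNorm_mono_measure _ Measure.restrict_le_self) _)
  filter_upwards [ae_restrict_mem hs] with x hx using hfg n x hx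

theorem tendsto_eLpNorm_sum {ι : Type*} (s : Finset ι) {f : ι → β → α → F} (hp : 1 ≤ p)
    (hf : ∀ i ∈ s, ∀ n, AEStronglyMeasurable (f i n) μ)
    (hlim : ∀ i ∈ s, Tendsto (fun n => eLpNorm (f i n) p μ) l (𝓝 0)) :
    Tendsto (fun n => eLpNorm (∑ i ∈ s, f i n) p μ) l (𝓝 0) := by
  have h1 : Tendsto (fun n => ∑ i ∈ s, eLpNorm (f i n) p μ) l (𝓝 0) := by
    simpa using tendsto_finsetSum s hlim
  exact tendsto_of_tendsto_of_tendsto_of_le_of_le tendsto_const_nhds h1 (fun _ => zero_le)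
    fun n => eLpNorm_sum_le (fun i hi => hf i hi n) hp

theorem tendsto_eLpNorm_add {f g : β → α → F} (hp : 1 ≤ p)
    (hf : ∀ n, AEStronglyMeasurable (f n) μ) (hg : ∀ n, AEStronglyMeasurable (g n) μ)
    (hf0 : Tendsto (fun n => eLpNorm (f n) p μ) l (𝓝 0))
    (hg0 : Tendsto (fun n => eLpNorm (g n) p μ) l (𝓝 0)) :
    Tendsto (fun n => eLpNorm (f n + g n) p μ) l (𝓝 0) := by
  have h1 := hf0.add hg0
  rw [add_zero] at h1
  exact tendsto_of_tendsto_of_tendsto_of_le_of_le tendsto_const_nhds h1 (fun _ => zero_le)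
    fun n => eLpNorm_add_le (hf n) (hg n) hp

end Limits

/-! ### Approximation and density -/

/-- A field with a distributional curl is approximated by smooth fields together with its curl. -/
theorem IsWeakCurl.exists_smooth_approximation {Ω : Opens R3} {p : ℝ≥0∞}
    (hbdd : Bornology.IsBounded (Ω : Set R3)) (hLip : HasLipschitzBoundary (Ω : Set R3))
    (hp1 : 1 ≤ p) (hp : p ≠ ⊤) {u w : R3 → R3} (h : IsWeakCurl Ω u w)
    (hu : MemLp u p (volume.restrict (Ω : Set R3)))
    (hw : MemLp w p (volume.restrict (Ω : Set R3))) :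
    ∃ v : ℕ → R3 → R3, (∀ n, ContDiff ℝ ∞ (v n)) ∧
      Tendsto (fun n => eLpNorm (v n - u) p (volume.restrict (Ω : Set R3))) atTop (𝓝 0) ∧
      Tendsto (fun n => eLpNorm (classicalCurl (v n) - w) p (volume.restrict (Ω : Set R3)))
        atTop (𝓝 0) := by
  have hΩm : MeasurableSet (Ω : Set R3) := Ω.isOpen.measurableSet
  obtain ⟨ι, _, χ, η, hχ, hsum, hη, hs, hsub⟩ :=
    hLip.exists_partition_mollifier Ω.isOpen hbdd
  set U : R3 → R3 := (Ω : Set R3).indicator u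
  set W : R3 → R3 := (Ω : Set R3).indicator w
  have hU : MemLp U p volume := (memLp_indicator_iff_restrict hΩm).mpr hu
  have hW : MemLp W p volume := (memLp_indicator_iff_restrict hΩm).mpr hw
  have hUl := hU.locallyIntegrable hp1
  have hWl := hW.locallyIntegrable hp1
  let mU : ι → ℕ → R3 → R3 := fun i n => η i n ⋆[ContinuousLinearMap.lsmul ℝ ℝ, volume] U
  let mW : ι → ℕ → R3 → R3 := fun i n => η i n ⋆[ContinuousLinearMap.lsmul ℝ ℝ, volume] W
  have hmU : ∀ i n, ContDiff ℝ ∞ (mU i n) := fun i n =>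
    (hη i n).hasCompactSupport.contDiff_convolution_left _ (hη i n).contDiff hUl
  have hmW : ∀ i n, ContDiff ℝ ∞ (mW i n) := fun i n =>
    (hη i n).hasCompactSupport.contDiff_convolution_left _ (hη i n).contDiff hWl
  have hlimU : ∀ i, Tendsto (fun n => eLpNorm (mU i n - U) p volume) atTop (𝓝 0) := fun i =>
    tendsto_eLpNorm_convolution_sub (hη i) (hs i) hp1 hp hU
  have hlimW : ∀ i, Tendsto (fun n => eLpNorm (mW i n - W) p volume) atTop (𝓝 0) := fun i =>
    tendsto_eLpNorm_convolution_sub (hη i) (hs i) hp1 hp hW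
  have hdχ : ∀ i, Continuous (fderiv ℝ (χ i)) := fun i => (hχ i).continuous_fderiv (by simp)
  have hbd : ∀ i, ∃ C, ∀ x ∈ (Ω : Set R3), ‖χ i x‖ ≤ C := fun i => by
    obtain ⟨C, hC⟩ := hbdd.isCompact_closure.exists_bound_of_continuousOn
      (hχ i).continuous.continuousOn
    exact ⟨C, fun x hx => hC x (subset_closure hx)⟩
  have hbd' : ∀ i, ∃ C, ∀ x ∈ (Ω : Set R3), ‖fderiv ℝ (χ i) x‖ ≤ C := fun i => by
    obtain ⟨C, hC⟩ := hbdd.isCompact_closure.exists_bound_of_continuousOn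
      (hdχ i).continuousOn
    exact ⟨C, fun x hx => hC x (subset_closure hx)⟩
  choose C hC using hbd
  choose C' hC' using hbd'
  have hdsum : ∀ x ∈ (Ω : Set R3), ∑ i, fderiv ℝ (χ i) x = 0 := fun x hx => by
    rw [← fderiv_fun_sum fun i _ => (hχ i).differentiable (by simp) x]
    have h1 : (fun y => ∑ i, χ i y) =ᶠ[𝓝 x] fun _ => (1 : ℝ) := by
      filter_upwards [Ω.isOpen.mem_nhds hx] with y hy using hsum y hy
    rw [h1.fderiv_eq, fderiv_const_apply]
  -- On `Ω`, `∑ i, f i n` is the error of the field and `∑ i, (g i n + k i n)` the error of its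
  -- curl, where `k` collects the terms `∇χ i × (mU i n - U)`.
  let f : ι → ℕ → R3 → R3 := fun i n x => χ i x • (mU i n - U) x
  let g : ι → ℕ → R3 → R3 := fun i n x => χ i x • (mW i n - W) x
  let k : ι → ℕ → R3 → R3 := fun i n x =>
    curlOfJacobian ((fderiv ℝ (χ i) x).smulRight ((mU i n - U) x))
  have hmeasU : ∀ i n, AEStronglyMeasurable (mU i n - U) (volume.restrict (Ω : Set R3)) :=
    fun i n => ((hmU i n).continuous.aestronglyMeasurable.sub hU.1).restrict
  have hmeasW : ∀ i n, AEStronglyMeasurable (mW i n - W) (volume.restrict (Ω : Set R3)) :=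
    fun i n => ((hmW i n).continuous.aestronglyMeasurable.sub hW.1).restrict
  have hf : ∀ i n, AEStronglyMeasurable (f i n) (volume.restrict (Ω : Set R3)) := fun i n =>
    (hχ i).continuous.aestronglyMeasurable.smul (hmeasU i n)
  have hg : ∀ i n, AEStronglyMeasurable (g i n) (volume.restrict (Ω : Set R3)) := fun i n =>
    (hχ i).continuous.aestronglyMeasurable.smul (hmeasW i n)
  have hk : ∀ i n, AEStronglyMeasurable (k i n) (volume.restrict (Ω : Set R3)) := fun i n =>
    curlOfJacobian.continuous.comp_aestronglyMeasurable
      ((ContinuousLinearMap.smulRightL ℝ R3 R3).aestronglyMeasurable_comp₂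
        (hdχ i).aestronglyMeasurable (hmeasU i n))
  refine ⟨fun n x => ∑ i, χ i x • mU i n x,
    fun n => ContDiff.sum fun i _ => (hχ i).smul (hmU i n), ?_, ?_⟩
  · have h1 := tendsto_eLpNorm_sum Finset.univ hp1 (fun i _ => hf i) fun i _ =>
      tendsto_eLpNorm_restrict_of_norm_le hΩm (C i) (fun n x hx => by
        rw [norm_smul]
        exact mul_le_mul_of_nonneg_right (hC i x hx) (norm_nonneg _)) (hlimU i)
    refine h1.congr fun n => eLpNorm_congr_ae ?_
    filter_upwards [ae_restrict_mem hΩm] with x hx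
    have hUx : U x = u x := Set.indicator_of_mem hx u
    simp only [f, Finset.sum_apply, Pi.sub_apply, smul_sub, Finset.sum_sub_distrib,
      ← Finset.sum_smul, hsum x hx, one_smul, hUx]
  · have h1 := tendsto_eLpNorm_sum Finset.univ hp1 (fun i _ => hg i) fun i _ =>
      tendsto_eLpNorm_restrict_of_norm_le hΩm (C i) (fun n x hx => by
        rw [norm_smul]
        exact mul_le_mul_of_nonneg_right (hC i x hx) (norm_nonneg _)) (hlimW i)
    have h2 := tendsto_eLpNorm_sum Finset.univ hp1 (fun i _ => hk i) fun i _ =>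
      tendsto_eLpNorm_restrict_of_norm_le hΩm (‖curlOfJacobian‖ * C' i) (fun n x hx => by
        refine (norm_curlOfJacobian_smulRight_le _ _).trans ?_
        gcongr
        exact hC' i x hx) (hlimU i)
    have h3 := tendsto_eLpNorm_add hp1
      (fun n => Finset.aestronglyMeasurable_sum _ fun i _ => hg i n)
      (fun n => Finset.aestronglyMeasurable_sum _ fun i _ => hk i n) h1 h2
    refine h3.congr fun n => eLpNorm_congr_ae ?_
    filter_upwards [ae_restrict_mem hΩm] with x hx
    have hWx : W x = w x := Set.indicator_of_mem hx w
    -- The curl commutes with mollification only where the window fits in `Ω`; elsewhere the cutoff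
    -- vanishes.
    have hcurl : ∀ i, χ i x • classicalCurl (mU i n) x = χ i x • mW i n x := fun i => by
      by_cases hxi : x ∈ tsupport (χ i)
      · rw [h.classicalCurl_convolution (hη i n).contDiff (hη i n).hasCompactSupport hUl hWl
          fun y hy => hsub i n x hx hxi y hy]
      · rw [image_eq_zero_of_notMem_tsupport hxi, zero_smul, zero_smul]
    -- Subtracting `U` costs nothing because `∑ i, ∇χ i × U = 0` on `Ω`.
    have hkx : ∑ i, k i n x =
        ∑ i, curlOfJacobian ((fderiv ℝ (χ i) x).smulRight (mU i n x)) := by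
      have h4 : ∑ i, curlOfJacobian ((fderiv ℝ (χ i) x).smulRight (U x)) = 0 := by
        have h5 : ∑ i, (fderiv ℝ (χ i) x).smulRight (U x) =
            (∑ i, fderiv ℝ (χ i) x).smulRight (U x) := by
          ext y : 1
          simp [Finset.sum_smul]
        rw [← map_sum, h5, hdsum x hx]
        simp
      rw [← sub_zero (∑ i, curlOfJacobian ((fderiv ℝ (χ i) x).smulRight (mU i n x))), ← h4,
        ← Finset.sum_sub_distrib]
      refine Finset.sum_congr rfl fun i _ => ?_
      simp only [k]
      rw [← map_sub]
      congr 1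
      ext y : 1
      simp [smul_sub]
    have hχd : ∀ i, DifferentiableAt ℝ (χ i) x := fun i => (hχ i).differentiable (by simp) x
    have hmd : ∀ i, DifferentiableAt ℝ (mU i n) x := fun i => (hmU i n).differentiable (by simp) x
    rw [Pi.sub_apply, classicalCurl_sum fun i _ => (hχd i).fun_smul (hmd i)]
    simp only [classicalCurl_smul (hχd _) (hmd _), hcurl, Finset.sum_add_distrib, ← hkx]
    simp only [g, Pi.add_apply, Finset.sum_apply, Pi.sub_apply, smul_sub, Finset.sum_sub_distrib,
      ← Finset.sum_smul, hsum x hx, one_smul, hWx]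
    abel

theorem mainTheorem11 (Ω : Opens R3) (hbdd : Bornology.IsBounded (Ω : Set R3))
    (hLip : HasLipschitzBoundary (Ω : Set R3))
    (p : ℝ≥0∞) [Fact (1 ≤ p)] (hp1 : 1 < p) (hp : p ≠ ⊤) :
    (∀ φ : R3 → R3, ContDiff ℝ ∞ φ → ∃ u : WCurl p Ω, u.Represents φ) ∧
      Dense (smoothFields p Ω) := by
  refine ⟨fun φ hφ => (WCurl.exists_represents hbdd hφ).imp fun _ h => h.1, fun u => ?_⟩
  obtain ⟨v, hv, hlim, hlim'⟩ := (WCurl.isWeakCurl_curl u).exists_smooth_approximation hbdd hLip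
    hp1.le hp (Lp.memLp _) (Lp.memLp _)
  choose V hV hV' using fun n => WCurl.exists_represents (p := p) hbdd (hv n)
  refine mem_closure_of_tendsto (f := V) (b := atTop) ?_
    (Eventually.of_forall fun n => ⟨v n, hv n, hV n⟩)
  have h1 : Tendsto (fun n => WCurl.toLp (V n)) atTop (𝓝 (WCurl.toLp u)) :=
    (Lp.tendsto_Lp_iff_tendsto_eLpNorm' _ _).mpr <| hlim.congr fun n =>
      eLpNorm_congr_ae ((hV n).symm.sub EventuallyEq.rfl)
  have h2 : Tendsto (fun n => WCurl.curl (V n)) atTop (𝓝 (WCurl.curl u)) :=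
    (Lp.tendsto_Lp_iff_tendsto_eLpNorm' _ _).mpr <| hlim'.congr fun n =>
      eLpNorm_congr_ae ((hV' n).symm.sub EventuallyEq.rfl)
  rw [tendsto_iff_norm_sub_tendsto_zero] at h1 h2 ⊢
  simpa only [WCurl.norm_def, map_sub, add_zero] using h1.add h2
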